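/- Let $M$ be a matroid of rank $r$ on a finite ground set $E$. Call $M$ transversal if there is a finite family $(A_1,\dots,A_m)$ of subsets of $E$ such that a set $I\subseteq E$ is independent in $M$ if and only if there is an injective map $f\colon I\to\{1,\dots,m\}$ with $x\in A_{f(x)}$ for all $x\in I$; call $M$ cotransversal if its dual matroid $M^*$ is transversal. Let $f_{k-1}$ be the number of $k$-element independent sets of $M$; the $h$-vector $(h_0,\dots,h_r)$ of (the independence complex of) $M$ is defined by $$\sum_{i=0}^r h_i t^i=\sum_{k=0}^r f_{k-1}\,t^k(1-t)^{r-k}.$$ A nonempty finite set $X$ of monomials in finitely many variables is an order ideal if every divisor of a monomial of $X$ belongs to $X$; it is pure if all monomials of $X$ that are maximal with respect to divisibility have the same degree. A pure $O$-sequence is a sequence whose $i$-th entry is the number of monomials of degree $i$ in such a pure order ideal $X$, for every $i\ge 0$; here finite sequences are identified if they differ only by trailing zeros. Theorem. If $M$ is cotransversal, then the $h$-vector of $M$ is a pure $O$-sequence. -/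

import Mathlib

open Polynomial

/-- `I` is a partial transversal of the family `A`: the elements of `I` can be matched injectively
to indices `j` with `x ∈ A j`. Equivalently, `I` is the set of left endpoints of a matching of
the bipartite graph of `A`. -/
def IsPartialTransversal {α ι : Type*} (A : ι → Set α) (I : Set α) : Prop :=
  ∃ f : I → ι, Function.Injective f ∧ ∀ x : I, (x : α) ∈ A (f x)

/-- `M` is transversal: for some finite family of subsets of the ground set, the independent sets
of `M` are exactly the partial transversals of the family. -/
def Matroid.IsTransversal {α : Type*} (M : Matroid α) : Prop :=
  ∃ (m : ℕ) (A : Fin m → Set α), (∀ j, A j ⊆ M.E) ∧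
    ∀ I : Set α, M.Indep I ↔ IsPartialTransversal A I

/-- `M` is cotransversal: its dual is transversal. -/
def Matroid.IsCotransversal {α : Type*} (M : Matroid α) : Prop :=
  M✶.IsTransversal

/-- The number of independent sets with `k` elements, that is, of faces of dimension `k - 1` of
the independence complex (`k = 0` is the empty face). -/
noncomputable def Matroid.numIndep {α : Type*} (M : Matroid α) (k : ℕ) : ℕ :=
  {I : Set α | M.Indep I ∧ I.encard = k}.ncard

/-- The `h`-polynomial `∑ₖ f_{k-1} tᵏ (1 - t)ʳ⁻ᵏ` of the independence complex of `M`, where `r` is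
the rank of `M`. -/
noncomputable def Matroid.hPolynomial {α : Type*} (M : Matroid α) : ℤ[X] :=
  ∑ k ∈ Finset.range (M.eRank.toNat + 1),
    (M.numIndep k : ℤ[X]) * X ^ k * (1 - X) ^ (M.eRank.toNat - k)

/-- The `h`-vector of the independence complex of `M`, extended by zeros beyond the rank. -/
noncomputable def Matroid.hVector {α : Type*} (M : Matroid α) (i : ℕ) : ℤ :=
  M.hPolynomial.coeff i

/-- A finite order ideal of monomials in the variables indexed by `σ`. A monomial is given by its
exponent vector, so that divisibility is the componentwise order. -/
def IsOrderIdealOfMonomials {σ : Type*} (S : Finset (σ →₀ ℕ)) : Prop :=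
  S.Nonempty ∧ ∀ u ∈ S, ∀ v, v ≤ u → v ∈ S

/-- All maximal monomials of `S` have the same degree. -/
def IsPureMonomialSet {σ : Type*} (S : Finset (σ →₀ ℕ)) : Prop :=
  ∀ u v, Maximal (· ∈ S) u → Maximal (· ∈ S) v → u.degree = v.degree

/-- `h` counts, degree by degree, the monomials of a pure order ideal in finitely many variables.
Finite sequences are regarded as functions on `ℕ` through extension by zeros. -/
def IsPureOSequence (h : ℕ → ℤ) : Prop :=
  ∃ (n : ℕ) (S : Finset (Fin n →₀ ℕ)), IsOrderIdealOfMonomials S ∧ IsPureMonomialSet S ∧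
    ∀ i, h i = ((S.filter fun u => u.degree = i).card : ℤ)

/-!
The matroid `M✶` is represented by the rows of a generic matrix `Z` supported on the bipartite graph
of a presentation of `M✶` by `rank M✶` sets, so the independent sets of `M` are the sets whose
complement indexes a spanning family of rows. For any family of vectors, consider in the symmetric
algebra of the space `V` containing them
* the span of the products of cospanning subfamilies (`productSpace`), and
* the polynomials on the dual of `V` whose degree along any line of direction `η` is less than the
  number of vectors not killed by `η` (`lineDegreeSpace`).

Dividing out one vector `v` gives a short exact sequence, multiplication by `v` followed by
restriction to `V / v`, along which the graded dimensions of the first space grow at least as fast,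
and those of the second at most as fast, as the coefficients of the `h`-polynomial, which satisfies
the corresponding deletion-contraction recurrence. Thus the dimensions of the first space are at
least the `h`-numbers, and those of the second at most.

For the rows of `Z` there is a monomial space in between. Expanding each factor of a product of
rows in coordinates shows that the products lie in the span of the monomials obtained by assigning
to every row of a cospanning set one of its coordinates. Conversely, Hall's theorem and the
genericity of `Z` bound the degrees of these monomials along all lines. So both inequalities are
equalities and the `h`-numbers count these monomials. They form an order ideal, and it is pure
because in a maximal assignment every nonzero row is either assigned or matched.
-/

section SymmetricAlgebra

open SymmetricAlgebra

variable {R M N : Type*} [CommRing R] [AddCommGroup M] [Module R M] [AddCommGroup N] [Module R N]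

/-- The homomorphism of symmetric algebras induced by a linear map. -/
noncomputable def symMap (φ : M →ₗ[R] N) : SymmetricAlgebra R M →ₐ[R] SymmetricAlgebra R N :=
  lift (ι R N ∘ₗ φ)

@[simp]
theorem symMap_ι (φ : M →ₗ[R] N) (w : M) : symMap φ (ι R M w) = ι R N (φ w) :=
  lift_ι_apply ..

variable (R M) in
/-- The degree `i` part of the symmetric algebra, spanned by the products of `i` vectors. -/
noncomputable def homogeneousPart (i : ℕ) : Submodule R (SymmetricAlgebra R M) :=
  LinearMap.range (ι R M) ^ i

theorem ι_mem_homogeneousPart_one (w : M) : ι R M w ∈ homogeneousPart R M 1 := by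
  rw [homogeneousPart, pow_one]
  exact LinearMap.mem_range_self ..

theorem mul_mem_homogeneousPart {i j : ℕ} {f g : SymmetricAlgebra R M}
    (hf : f ∈ homogeneousPart R M i) (hg : g ∈ homogeneousPart R M j) :
    f * g ∈ homogeneousPart R M (i + j) := by
  rw [homogeneousPart, pow_add]
  exact Submodule.mul_mem_mul hf hg

theorem symMap_mem_homogeneousPart (φ : M →ₗ[R] N) {i : ℕ} {f : SymmetricAlgebra R M}
    (hf : f ∈ homogeneousPart R M i) : symMap φ f ∈ homogeneousPart R N i := by
  have hrange : (LinearMap.range (ι R M)).map (symMap φ).toLinearMap ≤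
      LinearMap.range (ι R N) := by
    rintro _ ⟨_, ⟨w, rfl⟩, rfl⟩
    exact ⟨φ w, (symMap_ι φ w).symm⟩
  have hmem := Submodule.mem_map_of_mem (f := (symMap φ).toLinearMap) hf
  rw [homogeneousPart, Submodule.map_pow] at hmem
  exact pow_le_pow_left' hrange i hmem

instance finite_homogeneousPart [Module.Finite R M] (i : ℕ) :
    Module.Finite R (homogeneousPart R M i) :=
  Module.Finite.iff_fg.2 ((Module.Finite.iff_fg.1 inferInstance).pow i)

theorem homogeneousPart_eq_bot [Subsingleton M] {i : ℕ} (hi : i ≠ 0) :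
    homogeneousPart R M i = ⊥ := by
  rw [homogeneousPart, LinearMap.range_eq_bot.2 (Subsingleton.elim _ _), ← Submodule.zero_eq_bot,
    zero_pow hi]

theorem eq_zero_of_symMap_eq_zero {φ : M →ₗ[R] N} {f : SymmetricAlgebra R M}
    (hf : f ∈ homogeneousPart R M 0) (h : symMap φ f = 0) : f = 0 := by
  obtain ⟨c, rfl⟩ := Submodule.mem_one.1 hf
  rw [AlgHom.commutes, algebraMap_eq_zero_iff] at h
  rw [h, map_zero]

theorem exists_sub_symMap_eq_ι_mul {v : M} {p : M →ₗ[R] M} (hp : ∀ w, w - p w ∈ R ∙ v) {i : ℕ}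
    {f : SymmetricAlgebra R M} (hf : f ∈ homogeneousPart R M (i + 1)) :
    ∃ g ∈ homogeneousPart R M i, f - symMap p f = ι R M v * g := by
  suffices h : homogeneousPart R M (i + 1) ≤
      ((homogeneousPart R M i).map (LinearMap.mulLeft R (ι R M v))).comap
        (LinearMap.id - (symMap p).toLinearMap) by
    obtain ⟨g, hg, hfg⟩ := h hf
    exact ⟨g, hg, hfg.symm⟩
  have hι (w : M) : ∃ c : R, ι R M w - symMap p (ι R M w) = c • ι R M v := by
    obtain ⟨c, hc⟩ := Submodule.mem_span_singleton.1 (hp w)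
    exact ⟨c, by rw [symMap_ι, ← map_sub, ← hc, map_smul]⟩
  clear hf
  induction i with
  | zero =>
    rw [homogeneousPart, zero_add, pow_one]
    rintro _ ⟨w, rfl⟩
    obtain ⟨c, hc⟩ := hι w
    refine ⟨algebraMap R _ c, Submodule.algebraMap_mem c, ?_⟩
    change ι R M v * algebraMap R _ c = ι R M w - symMap p (ι R M w)
    rw [hc, Algebra.smul_def, mul_comm]
  | succ i ih =>
    rw [homogeneousPart, pow_succ, Submodule.mul_le]
    rintro a ha _ ⟨w, rfl⟩
    obtain ⟨g, hg, hag⟩ := ih ha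
    obtain ⟨c, hc⟩ := hι w
    refine ⟨g * ι R M w + c • symMap p a, add_mem
      (mul_mem_homogeneousPart hg (ι_mem_homogeneousPart_one w))
      (Submodule.smul_mem _ c (symMap_mem_homogeneousPart p ha)), ?_⟩
    replace hag : ι R M v * g = a - symMap p a := hag
    change ι R M v * (g * ι R M w + c • symMap p a) = a * ι R M w - symMap p (a * ι R M w)
    rw [map_mul, mul_add, ← mul_assoc, hag, mul_smul_comm, ← smul_mul_assoc, ← hc]
    ring

/-- The restriction of elements of the symmetric algebra, seen as polynomial functions on the dual
space, to the lines of direction `η`: in this reading it sends `f(x)` to `f(x + X η)`. -/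
noncomputable def restrictLine (η : Module.Dual R M) :
    SymmetricAlgebra R M →ₐ[R] (SymmetricAlgebra R M)[X] :=
  lift (CAlgHom.toLinearMap ∘ₗ ι R M + η.smulRight X)

theorem restrictLine_ι (η : Module.Dual R M) (w : M) :
    restrictLine η (ι R M w) = C (algebraMap R _ (η w)) * X + C (ι R M w) := by
  rw [restrictLine, lift_ι_apply, add_comm]
  simp [Algebra.smul_def]

theorem restrictLine_injective (η : Module.Dual R M) : Function.Injective (restrictLine η) := by
  have hcomp : ((aeval (0 : SymmetricAlgebra R M)).restrictScalars R).comp (restrictLine η) =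
      AlgHom.id R _ := algHom_ext (by ext w; simp [restrictLine_ι])
  exact Function.LeftInverse.injective fun f => AlgHom.congr_fun hcomp f

theorem restrictLine_symMap (φ : M →ₗ[R] N) (η : Module.Dual R N) (f : SymmetricAlgebra R M) :
    restrictLine η (symMap φ f) =
      (restrictLine (η ∘ₗ φ) f).map (symMap φ : SymmetricAlgebra R M →+* _) := by
  have hcomp : (restrictLine η).comp (symMap φ) =
      (mapAlgHom (symMap φ)).comp (restrictLine (η ∘ₗ φ)) :=
    algHom_ext (by ext w; simp [restrictLine_ι])
  exact AlgHom.congr_fun hcomp f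

variable {K V : Type*} [Field K] [AddCommGroup V] [Module K V]

theorem finrank_homogeneousPart_zero_le : Module.finrank K (homogeneousPart K V 0) ≤ 1 := by
  rw [homogeneousPart, pow_zero, Submodule.one_eq_span]
  exact (finrank_span_singleton one_ne_zero).le

theorem exists_eq_ι_mul_of_symMap_mkQ_eq_zero {v : V} {i : ℕ} {f : SymmetricAlgebra K V}
    (hf : f ∈ homogeneousPart K V (i + 1)) (h : symMap (K ∙ v).mkQ f = 0) :
    ∃ g ∈ homogeneousPart K V i, f = ι K V v * g := by
  obtain ⟨s, hs⟩ := (K ∙ v).mkQ.exists_rightInverse_of_surjective (K ∙ v).range_mkQ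
  have hcomp : symMap (s ∘ₗ (K ∙ v).mkQ) = (symMap s).comp (symMap (K ∙ v).mkQ) :=
    algHom_ext (by ext w; simp)
  have hp (w : V) : w - (s ∘ₗ (K ∙ v).mkQ) w ∈ K ∙ v :=
    (Submodule.Quotient.eq _).1 (LinearMap.congr_fun hs _).symm
  obtain ⟨g, hg, hfg⟩ := exists_sub_symMap_eq_ι_mul hp hf
  refine ⟨g, hg, ?_⟩
  rwa [hcomp, AlgHom.comp_apply, h, map_zero, sub_zero] at hfg

theorem symMap_mkQ_ι_mul {v : V} (f : SymmetricAlgebra K V) :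
    symMap (K ∙ v).mkQ (ι K V v * f) = 0 := by
  have hv : (K ∙ v).mkQ v = 0 :=
    (Submodule.Quotient.mk_eq_zero _).2 (Submodule.mem_span_singleton_self v)
  rw [map_mul, symMap_ι, hv, map_zero, zero_mul]

theorem ι_ne_zero {w : V} (hw : w ≠ 0) : ι K V w ≠ 0 := by
  obtain ⟨η, hη⟩ := Module.Projective.exists_dual_ne_zero K hw
  intro h
  apply hη
  rw [← lift_ι_apply η w, h, map_zero]

open Classical in
theorem degree_restrictLine_ι_mul (η : Module.Dual K V) {w : V} (hw : w ≠ 0)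
    (f : SymmetricAlgebra K V) :
    (restrictLine η (ι K V w * f)).degree =
      (if η w = 0 then 0 else 1) + (restrictLine η f).degree := by
  rw [map_mul, degree_mul, restrictLine_ι]
  split_ifs with h
  · simp [h, degree_C (ι_ne_zero hw)]
  · rw [degree_linear (by simpa using h)]

end SymmetricAlgebra

section CospanningSets

open Module

variable {K : Type*} [Field K] {V : Type*} [AddCommGroup V] [Module K V]

theorem finrank_quotient_span_singleton_add_one [FiniteDimensional K V] {w : V} (hw : w ≠ 0) :
    finrank K (V ⧸ K ∙ w) + 1 = finrank K V := by
  rw [← finrank_span_singleton (K := K) hw, Submodule.finrank_quotient_add_finrank]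

variable {κ : Type*} {v : κ → V}

theorem finrank_le_card_of_span_image_eq_top {T : Finset κ}
    (h : Submodule.span K (v '' T) = ⊤) : finrank K V ≤ T.card := by
  classical
  rw [← finrank_top, ← h, ← Finset.coe_image]
  exact (finrank_span_finset_le_card _).trans Finset.card_image_le

theorem span_mkQ_image_eq_top_iff {e : κ} {T : Set κ} :
    Submodule.span K ((K ∙ v e).mkQ ∘ v '' T) = ⊤ ↔ Submodule.span K (v '' insert e T) = ⊤ := by
  rw [Set.image_comp, Submodule.span_image, Submodule.map_mkQ_eq_top, Set.image_insert_eq,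
    Submodule.span_insert]

theorem span_image_insert_of_eq_zero {e : κ} {T : Set κ} (he : v e = 0) :
    Submodule.span K (v '' insert e T) = Submodule.span K (v '' T) := by
  rw [Set.image_insert_eq, he, Submodule.span_insert_zero]

variable [DecidableEq κ]

open Classical in
variable (K) in
/-- The subsets of `E` whose complement in `E` indexes a spanning family of vectors. These are the
independent sets of the dual of the matroid of linear dependencies of the family. -/
noncomputable def cospanning (v : κ → V) (E : Finset κ) : Finset (Finset κ) :=
  {Y ∈ E.powerset | Submodule.span K (v '' (E \ Y : Finset κ)) = ⊤}

variable {E : Finset κ} {e : κ}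

theorem mem_cospanning {Y : Finset κ} :
    Y ∈ cospanning K v E ↔ Y ⊆ E ∧ Submodule.span K (v '' (E \ Y : Finset κ)) = ⊤ := by
  rw [cospanning, Finset.mem_filter, Finset.mem_powerset]

theorem cospanning_mono {F : Finset κ} (hEF : E ⊆ F) : cospanning K v E ⊆ cospanning K v F := by
  intro Y hY
  rw [mem_cospanning] at hY ⊢
  exact ⟨hY.1.trans hEF, top_unique (hY.2.ge.trans (Submodule.span_mono
    (Set.image_mono (Finset.coe_subset.2 (Finset.sdiff_subset_sdiff hEF subset_rfl)))))⟩

theorem insert_mem_cospanning_iff (he : e ∉ E) {Y : Finset κ} (hY : Y ⊆ E) :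
    insert e Y ∈ cospanning K v (insert e E) ↔ Y ∈ cospanning K v E := by
  rw [mem_cospanning, mem_cospanning, Finset.insert_sdiff_insert, Finset.sdiff_insert_of_notMem he,
    Finset.insert_subset_insert_iff fun h => he (hY h)]

theorem mem_cospanning_insert_iff (he : e ∉ E) {Y : Finset κ} (hY : Y ⊆ E) :
    Y ∈ cospanning K v (insert e E) ↔ Y ∈ cospanning K ((K ∙ v e).mkQ ∘ v) E := by
  rw [mem_cospanning, mem_cospanning, span_mkQ_image_eq_top_iff,
    Finset.insert_sdiff_of_notMem _ fun h => he (hY h), Finset.coe_insert]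
  simp only [hY, hY.trans (Finset.subset_insert e E), true_and]

theorem cospanning_mkQ_of_eq_zero (h0 : v e = 0) :
    cospanning K ((K ∙ v e).mkQ ∘ v) E = cospanning K v E := by
  ext Y
  rw [mem_cospanning, mem_cospanning, span_mkQ_image_eq_top_iff, span_image_insert_of_eq_zero h0]

open Classical in
theorem sum_cospanning {A : Type*} [AddCommMonoid A] (f : Finset κ → A) :
    ∑ Y ∈ cospanning K v E, f Y = ∑ Y ∈ E.powerset, if Y ∈ cospanning K v E then f Y else 0 := by
  rw [← Finset.sum_filter, Finset.filter_mem_eq_inter, Finset.inter_eq_right.2]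
  exact Finset.filter_subset ..

theorem sum_cospanning_insert {A : Type*} [AddCommMonoid A] (he : e ∉ E) (f : Finset κ → A) :
    ∑ Y ∈ cospanning K v (insert e E), f Y =
      ∑ Y ∈ cospanning K ((K ∙ v e).mkQ ∘ v) E, f Y + ∑ Y ∈ cospanning K v E, f (insert e Y) := by
  classical
  rw [sum_cospanning, sum_cospanning, sum_cospanning, Finset.sum_powerset_insert he]
  congr 1 <;> refine Finset.sum_congr rfl fun Y hY => ?_ <;> rw [Finset.mem_powerset] at hY
  · simp only [mem_cospanning_insert_iff he hY]
  · simp only [insert_mem_cospanning_iff he hY]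

theorem finrank_add_card_le {Y : Finset κ} (hY : Y ∈ cospanning K v E) :
    finrank K V + Y.card ≤ E.card := by
  obtain ⟨hYE, hspan⟩ := mem_cospanning.1 hY
  have hle := finrank_le_card_of_span_image_eq_top hspan
  have hcard := Finset.card_sdiff_add_card_eq_card hYE
  omega

variable (K) in
/-- The `h`-polynomial `∑ X ^ #Y * (1 - X) ^ (r - #Y)` of the complex of cospanning sets, all of
whose facets have `r = #E - dim V` elements as soon as the whole family spans. -/
noncomputable def cospanningHPolynomial (v : κ → V) (E : Finset κ) : ℤ[X] :=
  ∑ Y ∈ cospanning K v E, X ^ Y.card * (1 - X) ^ (E.card - finrank K V - Y.card)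

theorem cospanningHPolynomial_insert_of_eq_zero (he : e ∉ E) (h0 : v e = 0) :
    cospanningHPolynomial K v (insert e E) = cospanningHPolynomial K v E := by
  rw [cospanningHPolynomial, sum_cospanning_insert he, cospanning_mkQ_of_eq_zero h0,
    ← Finset.sum_add_distrib, cospanningHPolynomial]
  refine Finset.sum_congr rfl fun Y hY => ?_
  have hle := finrank_add_card_le hY
  have heY : e ∉ Y := fun h => he ((mem_cospanning.1 hY).1 h)
  rw [Finset.card_insert_of_notMem he, Finset.card_insert_of_notMem heY,
    show E.card + 1 - finrank K V - Y.card = E.card - finrank K V - Y.card + 1 by omega,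
    show E.card + 1 - finrank K V - (Y.card + 1) = E.card - finrank K V - Y.card by omega]
  ring

theorem cospanningHPolynomial_insert_of_ne_zero [FiniteDimensional K V] (he : e ∉ E)
    (h0 : v e ≠ 0) : cospanningHPolynomial K v (insert e E) =
      cospanningHPolynomial K ((K ∙ v e).mkQ ∘ v) E + X * cospanningHPolynomial K v E := by
  have hdim := finrank_quotient_span_singleton_add_one (K := K) h0
  rw [cospanningHPolynomial, sum_cospanning_insert he, Finset.card_insert_of_notMem he,
    cospanningHPolynomial, cospanningHPolynomial, Finset.mul_sum]
  congr 1 <;> refine Finset.sum_congr rfl fun Y hY => ?_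
  · congr 2
    omega
  · have heY : e ∉ Y := fun h => he ((mem_cospanning.1 hY).1 h)
    rw [Finset.card_insert_of_notMem heY, pow_succ', mul_assoc]
    congr 3
    omega

theorem cospanning_empty_of_nontrivial [Nontrivial V] :
    cospanning K v ∅ = ∅ := by
  refine Finset.eq_empty_of_forall_notMem fun Y hY => ?_
  have h := (mem_cospanning.1 hY).2
  rw [Finset.empty_sdiff, Finset.coe_empty, Set.image_empty, Submodule.span_empty] at h
  exact bot_ne_top h

theorem cospanningHPolynomial_empty_of_subsingleton [Subsingleton V] :
    cospanningHPolynomial K v ∅ = 1 := by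
  have h : cospanning K v ∅ = {∅} := by
    ext Y
    simp [mem_cospanning, Subsingleton.elim _ (⊤ : Submodule K V)]
  simp [cospanningHPolynomial, h]

end CospanningSets

section RankNullity

open SymmetricAlgebra Module

variable {K : Type*} [Field K]

theorem finrank_map_add_finrank_inf_ker {U W : Type*} [AddCommGroup U] [Module K U]
    [AddCommGroup W] [Module K W] (f : U →ₗ[K] W) (L : Submodule K U) [FiniteDimensional K L] :
    finrank K (L.map f) + finrank K (L ⊓ LinearMap.ker f : Submodule K U) = finrank K L := by
  rw [← (f.domRestrict L).finrank_range_add_finrank_ker, LinearMap.range_domRestrict,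
    LinearMap.ker_domRestrict, ← L.finrank_map_subtype_eq, L.map_comap_subtype]

variable {V : Type*} [AddCommGroup V] [Module K V]

theorem finrank_map_mulLeft_ι {w : V} (hw : w ≠ 0) (L : Submodule K (SymmetricAlgebra K V)) :
    finrank K (L.map (LinearMap.mulLeft K (ι K V w))) = finrank K L :=
  (L.equivMapOfInjective _ (mul_right_injective₀ (ι_ne_zero hw))).finrank_eq.symm

end RankNullity

section ProductSpace

open SymmetricAlgebra Module

variable {K : Type*} [Field K] {V : Type*} [AddCommGroup V] [Module K V]
  {κ : Type*} [DecidableEq κ] {v : κ → V} {E : Finset κ} {e : κ} {i : ℕ}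

variable (K) in
/-- The span of the products `∏ e ∈ Y, v e` in the symmetric algebra over the cospanning sets `Y`
of size `i`: the degree `i` part of the central zonotopal space in its description by
generators. -/
noncomputable def productSpace (v : κ → V) (E : Finset κ) (i : ℕ) :
    Submodule K (SymmetricAlgebra K V) :=
  Submodule.span K ((fun Y => ∏ a ∈ Y, ι K V (v a)) '' {Y | Y ∈ cospanning K v E ∧ Y.card = i})

theorem prod_mem_productSpace {Y : Finset κ} (hY : Y ∈ cospanning K v E) :
    ∏ a ∈ Y, ι K V (v a) ∈ productSpace K v E Y.card :=
  Submodule.subset_span ⟨Y, ⟨hY, rfl⟩, rfl⟩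

theorem one_mem_productSpace_empty [Subsingleton V] : 1 ∈ productSpace K v ∅ 0 := by
  have hmem : ∅ ∈ cospanning K v ∅ := mem_cospanning.2 ⟨subset_rfl, Subsingleton.elim _ _⟩
  simpa using prod_mem_productSpace hmem

theorem productSpace_le_iff {P : Submodule K (SymmetricAlgebra K V)} :
    productSpace K v E i ≤ P ↔
      ∀ Y ∈ cospanning K v E, Y.card = i → ∏ a ∈ Y, ι K V (v a) ∈ P := by
  rw [productSpace, Submodule.span_le, Set.image_subset_iff]
  exact ⟨fun h Y hY hi => h ⟨hY, hi⟩, fun h Y hY => h Y hY.1 hY.2⟩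

theorem productSpace_mono {F : Finset κ} (hEF : E ⊆ F) :
    productSpace K v E i ≤ productSpace K v F i := by
  rw [productSpace_le_iff]
  rintro Y hY rfl
  exact prod_mem_productSpace (cospanning_mono hEF hY)

theorem map_mulLeft_productSpace_le (he : e ∉ E) :
    (productSpace K v E i).map (LinearMap.mulLeft K (ι K V (v e))) ≤
      productSpace K v (insert e E) (i + 1) := by
  rw [Submodule.map_le_iff_le_comap, productSpace_le_iff]
  rintro Y hY rfl
  have hYE := (mem_cospanning.1 hY).1
  have heY : e ∉ Y := fun h => he (hYE h)
  rw [Submodule.mem_comap, LinearMap.mulLeft_apply,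
    ← Finset.prod_insert heY (f := fun a => ι K V (v a)), ← Finset.card_insert_of_notMem heY]
  exact prod_mem_productSpace ((insert_mem_cospanning_iff he hYE).2 hY)

theorem productSpace_mkQ_le_map (he : e ∉ E) :
    productSpace K ((K ∙ v e).mkQ ∘ v) E i ≤
      (productSpace K v (insert e E) i).map (symMap (K ∙ v e).mkQ).toLinearMap := by
  rw [productSpace_le_iff]
  rintro Y hY rfl
  refine ⟨_, prod_mem_productSpace
    ((mem_cospanning_insert_iff he (mem_cospanning.1 hY).1).2 hY), ?_⟩
  simp [map_prod]

instance finiteDimensional_productSpace : FiniteDimensional K (productSpace K v E i) :=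
  FiniteDimensional.span_of_finite K
    (((cospanning K v E).finite_toSet.subset fun _ hY => hY.1).image _)

theorem finrank_productSpace_insert_succ_le (he : e ∉ E) (h0 : v e ≠ 0) :
    finrank K (productSpace K ((K ∙ v e).mkQ ∘ v) E (i + 1)) + finrank K (productSpace K v E i) ≤
      finrank K (productSpace K v (insert e E) (i + 1)) := by
  have hker : (productSpace K v E i).map (LinearMap.mulLeft K (ι K V (v e))) ≤
      productSpace K v (insert e E) (i + 1) ⊓ LinearMap.ker (symMap (K ∙ v e).mkQ).toLinearMap := by
    refine le_inf (map_mulLeft_productSpace_le he) ?_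
    rintro _ ⟨f, -, rfl⟩
    exact symMap_mkQ_ι_mul f
  rw [← finrank_map_add_finrank_inf_ker (symMap (K ∙ v e).mkQ).toLinearMap
    (productSpace K v (insert e E) (i + 1)), ← finrank_map_mulLeft_ι h0 (productSpace K v E i)]
  exact add_le_add (Submodule.finrank_mono (productSpace_mkQ_le_map he))
    (Submodule.finrank_mono hker)

theorem coeff_le_finrank_productSpace [FiniteDimensional K V] :
    (cospanningHPolynomial K v E).coeff i ≤ finrank K (productSpace K v E i) := by
  induction E using Finset.induction_on generalizing V i with
  | empty =>
    rcases subsingleton_or_nontrivial V with _ | _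
    · rw [cospanningHPolynomial_empty_of_subsingleton, coeff_one]
      split_ifs with hi
      · have hne : productSpace K v ∅ 0 ≠ ⊥ :=
          (Submodule.ne_bot_iff _).2 ⟨1, one_mem_productSpace_empty, one_ne_zero⟩
        rw [hi]
        exact_mod_cast Submodule.one_le_finrank_iff.2 hne
      · positivity
    · simp [cospanningHPolynomial, cospanning_empty_of_nontrivial]
  | insert e E he ih =>
    by_cases h0 : v e = 0
    · rw [cospanningHPolynomial_insert_of_eq_zero he h0]
      exact ih.trans
        (mod_cast Submodule.finrank_mono (productSpace_mono (Finset.subset_insert e E)))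
    rw [cospanningHPolynomial_insert_of_ne_zero he h0, coeff_add]
    cases i with
    | zero =>
      rw [coeff_X_mul_zero, add_zero]
      exact ih.trans (mod_cast (Submodule.finrank_mono (productSpace_mkQ_le_map he)).trans
        (Submodule.finrank_map_le _ _))
    | succ i =>
      rw [coeff_X_mul]
      exact (add_le_add ih ih).trans (mod_cast finrank_productSpace_insert_succ_le he h0)

end ProductSpace

section LineDegreeSpace

open SymmetricAlgebra Module

variable {K : Type*} [Field K] {V : Type*} [AddCommGroup V] [Module K V]
  {κ : Type*} {v : κ → V} {E : Finset κ} {e : κ} {i : ℕ}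

open Classical in
/-- The number of hyperplanes `v a = 0`, `a ∈ E`, of the dual space that are transverse to the
direction `η`. It bounds the degrees in `lineDegreeSpace`. -/
noncomputable def nonvanishingCount (v : κ → V) (E : Finset κ) (η : Dual K V) : ℕ :=
  {a ∈ E | η (v a) ≠ 0}.card

variable (K) in
/-- The homogeneous elements of degree `i` whose restriction to every line of direction `η` has
degree less than the number of `a ∈ E` with `η (v a) ≠ 0`: the degree `i` part of the central
zonotopal space in its description by conditions on lines. -/
noncomputable def lineDegreeSpace (v : κ → V) (E : Finset κ) (i : ℕ) :
    Submodule K (SymmetricAlgebra K V) :=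
  homogeneousPart K V i ⊓ ⨅ (η : Dual K V) (_ : η ≠ 0),
    ((degreeLT (SymmetricAlgebra K V) (nonvanishingCount v E η)).restrictScalars K).comap
      (restrictLine η).toLinearMap

theorem mem_lineDegreeSpace {f : SymmetricAlgebra K V} :
    f ∈ lineDegreeSpace K v E i ↔ f ∈ homogeneousPart K V i ∧
      ∀ η : Dual K V, η ≠ 0 → (restrictLine η f).degree < nonvanishingCount v E η := by
  simp [lineDegreeSpace, mem_degreeLT]

theorem lineDegreeSpace_le_homogeneousPart : lineDegreeSpace K v E i ≤ homogeneousPart K V i :=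
  inf_le_left

theorem lineDegreeSpace_empty_of_nontrivial [Nontrivial V] : lineDegreeSpace K v ∅ i = ⊥ := by
  obtain ⟨w, hw⟩ := exists_ne (0 : V)
  obtain ⟨η, hη⟩ := Module.Projective.exists_dual_ne_zero K hw
  refine (Submodule.eq_bot_iff _).2 fun f hf => ?_
  have hdeg := (mem_lineDegreeSpace.1 hf).2 η fun h => hη (by rw [h, LinearMap.zero_apply])
  rw [nonvanishingCount, Finset.filter_empty, Finset.card_empty, Nat.cast_zero,
    Nat.WithBot.lt_zero_iff, degree_eq_bot] at hdeg
  exact (map_eq_zero_iff _ (restrictLine_injective η)).1 hdeg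

instance finiteDimensional_lineDegreeSpace [FiniteDimensional K V] :
    FiniteDimensional K (lineDegreeSpace K v E i) :=
  Submodule.finiteDimensional_of_le lineDegreeSpace_le_homogeneousPart

variable [DecidableEq κ]

open Classical in
theorem nonvanishingCount_insert (he : e ∉ E) (η : Dual K V) :
    nonvanishingCount v (insert e E) η =
      (if η (v e) = 0 then 0 else 1) + nonvanishingCount v E η := by
  by_cases h : η (v e) = 0 <;>
    simp [nonvanishingCount, Finset.filter_insert, h, he, add_comm]

theorem lineDegreeSpace_insert_of_eq_zero (he : e ∉ E) (h0 : v e = 0) :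
    lineDegreeSpace K v (insert e E) i = lineDegreeSpace K v E i := by
  ext f
  simp [mem_lineDegreeSpace, nonvanishingCount_insert he, h0]

theorem map_symMap_lineDegreeSpace_le (he : e ∉ E) :
    (lineDegreeSpace K v (insert e E) i).map (symMap (K ∙ v e).mkQ).toLinearMap ≤
      lineDegreeSpace K ((K ∙ v e).mkQ ∘ v) E i := by
  rintro _ ⟨f, hf, rfl⟩
  obtain ⟨hfi, hdeg⟩ := mem_lineDegreeSpace.1 hf
  refine mem_lineDegreeSpace.2 ⟨symMap_mem_homogeneousPart _ hfi, fun η hη => ?_⟩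
  have hcomp : η ∘ₗ (K ∙ v e).mkQ ≠ 0 := by
    contrapose! hη
    exact Submodule.linearMap_qext _ hη
  have hve : (K ∙ v e).mkQ (v e) = 0 := by simp
  have hlt := hdeg _ hcomp
  rw [nonvanishingCount_insert he, LinearMap.comp_apply, hve, map_zero, if_pos rfl, zero_add] at hlt
  change (restrictLine η (symMap _ f)).degree < _
  rw [restrictLine_symMap]
  exact degree_map_le.trans_lt hlt

theorem mem_lineDegreeSpace_of_ι_mul_mem (he : e ∉ E) (h0 : v e ≠ 0) {j : ℕ}
    {g : SymmetricAlgebra K V} (hg : g ∈ homogeneousPart K V i)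
    (hmul : ι K V (v e) * g ∈ lineDegreeSpace K v (insert e E) j) :
    g ∈ lineDegreeSpace K v E i := by
  refine mem_lineDegreeSpace.2 ⟨hg, fun η hη => ?_⟩
  have hlt := (mem_lineDegreeSpace.1 hmul).2 η hη
  rw [degree_restrictLine_ι_mul η h0, nonvanishingCount_insert he] at hlt
  split_ifs at hlt with h
  · simpa using hlt
  · rw [Nat.cast_add, Nat.cast_one] at hlt
    exact lt_of_add_lt_add_left hlt

theorem lineDegreeSpace_inf_ker_le (he : e ∉ E) (h0 : v e ≠ 0) :
    lineDegreeSpace K v (insert e E) (i + 1) ⊓ LinearMap.ker (symMap (K ∙ v e).mkQ).toLinearMap ≤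
      (lineDegreeSpace K v E i).map (LinearMap.mulLeft K (ι K V (v e))) := by
  rintro f ⟨hf, hker⟩
  obtain ⟨g, hg, rfl⟩ := exists_eq_ι_mul_of_symMap_mkQ_eq_zero (mem_lineDegreeSpace.1 hf).1 hker
  exact ⟨g, mem_lineDegreeSpace_of_ι_mul_mem he h0 hg hf, rfl⟩

theorem finrank_lineDegreeSpace_insert_zero_le [FiniteDimensional K V] (he : e ∉ E) :
    finrank K (lineDegreeSpace K v (insert e E) 0) ≤
      finrank K (lineDegreeSpace K ((K ∙ v e).mkQ ∘ v) E 0) := by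
  have hbot : lineDegreeSpace K v (insert e E) 0 ⊓
      LinearMap.ker (symMap (K ∙ v e).mkQ).toLinearMap = ⊥ :=
    (Submodule.eq_bot_iff _).2 fun f hf =>
      eq_zero_of_symMap_eq_zero (mem_lineDegreeSpace.1 hf.1).1 hf.2
  rw [← finrank_map_add_finrank_inf_ker (symMap (K ∙ v e).mkQ).toLinearMap, hbot, finrank_bot,
    add_zero]
  exact Submodule.finrank_mono (map_symMap_lineDegreeSpace_le he)

theorem finrank_lineDegreeSpace_insert_succ_le [FiniteDimensional K V] (he : e ∉ E)
    (h0 : v e ≠ 0) : finrank K (lineDegreeSpace K v (insert e E) (i + 1)) ≤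
      finrank K (lineDegreeSpace K ((K ∙ v e).mkQ ∘ v) E (i + 1)) +
        finrank K (lineDegreeSpace K v E i) := by
  rw [← finrank_map_add_finrank_inf_ker (symMap (K ∙ v e).mkQ).toLinearMap,
    ← finrank_map_mulLeft_ι h0 (lineDegreeSpace K v E i)]
  exact add_le_add (Submodule.finrank_mono (map_symMap_lineDegreeSpace_le he))
    (Submodule.finrank_mono (lineDegreeSpace_inf_ker_le he h0))

theorem finrank_lineDegreeSpace_le_coeff [FiniteDimensional K V] :
    finrank K (lineDegreeSpace K v E i) ≤ (cospanningHPolynomial K v E).coeff i := by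
  induction E using Finset.induction_on generalizing V i with
  | empty =>
    rcases subsingleton_or_nontrivial V with _ | _
    · rw [cospanningHPolynomial_empty_of_subsingleton, coeff_one]
      have hle : finrank K (lineDegreeSpace K v ∅ i) ≤ finrank K (homogeneousPart K V i) :=
        Submodule.finrank_mono lineDegreeSpace_le_homogeneousPart
      split_ifs with hi
      · subst hi
        exact_mod_cast hle.trans finrank_homogeneousPart_zero_le
      · rw [homogeneousPart_eq_bot hi, finrank_bot] at hle
        exact_mod_cast hle
    · rw [lineDegreeSpace_empty_of_nontrivial]
      simp [cospanningHPolynomial, cospanning_empty_of_nontrivial]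
  | insert e E he ih =>
    by_cases h0 : v e = 0
    · rw [cospanningHPolynomial_insert_of_eq_zero he h0, lineDegreeSpace_insert_of_eq_zero he h0]
      exact ih
    rw [cospanningHPolynomial_insert_of_ne_zero he h0, coeff_add]
    cases i with
    | zero =>
      rw [coeff_X_mul_zero, add_zero]
      exact le_trans (mod_cast finrank_lineDegreeSpace_insert_zero_le he) ih
    | succ i =>
      rw [coeff_X_mul]
      exact le_trans (mod_cast finrank_lineDegreeSpace_insert_succ_le he h0) (add_le_add ih ih)

end LineDegreeSpace

section Matching

variable {κ J : Type*} {R : κ → J → Prop} {T U : Finset κ}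

/-- The bipartite graph `R` has a matching that saturates `J` and meets the other side only inside
`T`. -/
def MatchesInto (R : κ → J → Prop) (T : Finset κ) : Prop :=
  ∃ g : J → κ, Function.Injective g ∧ ∀ j, g j ∈ T ∧ R (g j) j

theorem MatchesInto.mono (hTU : T ⊆ U) : MatchesInto R T → MatchesInto R U :=
  fun ⟨g, hg, hgT⟩ => ⟨g, hg, fun j => ⟨hTU (hgT j).1, (hgT j).2⟩⟩

theorem exists_injective_of_card_le_card_biUnion [DecidableEq J] {t : κ → Finset J}
    (h : ∀ u ⊆ T, u.card ≤ (u.biUnion t).card) :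
    ∃ f : T → J, Function.Injective f ∧ ∀ e : T, f e ∈ t e := by
  classical
  refine (Finset.all_card_le_biUnion_card_iff_exists_injective fun e : T => t e).1 fun u => ?_
  have hu := h (u.image Subtype.val) (Finset.image_subset_iff.2 fun e _ => e.2)
  rwa [Finset.card_image_of_injective _ Subtype.val_injective, Finset.image_biUnion] at hu

theorem exists_subset_biUnion_eq_image [DecidableEq J] {t : κ → Finset J} (hT : T.Nonempty)
    (ht : ∀ e ∈ T, (t e).Nonempty) (hcard : (T.biUnion t).card ≤ T.card) :
    ∃ s ⊆ T, s.Nonempty ∧ ∃ f : s → J, Function.Injective f ∧ (∀ e : s, f e ∈ t e) ∧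
      s.biUnion t = Finset.univ.image f := by
  classical
  obtain ⟨s, ⟨hsT, hs, hscard⟩, hmin⟩ := exists_minimal_of_wellFoundedLT
    (fun s => s ⊆ T ∧ s.Nonempty ∧ (s.biUnion t).card ≤ s.card) ⟨T, subset_rfl, hT, hcard⟩
  have hall (u : Finset κ) (hus : u ⊆ s) : u.card ≤ (u.biUnion t).card := by
    by_contra! hlt
    obtain ⟨e, he⟩ : u.Nonempty := Finset.card_pos.1 (by omega)
    have herase : ((u.erase e).biUnion t).card ≤ (u.erase e).card := by
      rw [Finset.card_erase_of_mem he]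
      exact (Finset.card_le_card (Finset.biUnion_subset_biUnion_of_subset_left t
        (Finset.erase_subset e u))).trans (by omega)
    have hne : (u.erase e).Nonempty := by
      rw [← Finset.card_pos, Finset.card_erase_of_mem he]
      have hte := (ht e (hsT (hus he))).card_pos
      have hle := Finset.card_le_card (Finset.subset_biUnion_of_mem t he)
      omega
    exact Finset.notMem_erase e u (hmin ⟨(Finset.erase_subset e u).trans (hus.trans hsT), hne,
      herase⟩ ((Finset.erase_subset e u).trans hus) (hus he))
  obtain ⟨f, hf, hft⟩ := exists_injective_of_card_le_card_biUnion hall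
  refine ⟨s, hsT, hs, f, hf, hft, (Finset.eq_of_subset_of_card_le ?_ ?_).symm⟩
  · exact Finset.image_subset_iff.2 fun e _ => Finset.mem_biUnion.2 ⟨e, e.2, hft e⟩
  · rwa [Finset.card_image_of_injective _ hf, Finset.card_univ, Fintype.card_coe]

end Matching

section GenericMatrix

variable {κ J K : Type*} [Field K] {R : κ → J → Prop} {Z : Matrix κ J K}

/-- A matrix supported on the relation `R` in which every square submatrix whose diagonal lies in
`R` is invertible. Indexing the submatrices by `Fin n` avoids a quantifier over types. -/
structure IsGenericMatrix (R : κ → J → Prop) (Z : Matrix κ J K) : Prop where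
  rel_of_ne_zero : ∀ {e j}, Z e j ≠ 0 → R e j
  det_submatrix_fin_ne_zero : ∀ {n : ℕ} {r : Fin n → κ} {c : Fin n → J}, Function.Injective r →
    Function.Injective c → (∀ k, R (r k) (c k)) → (Z.submatrix r c).det ≠ 0

open Classical in
/-- The matrix with an independent indeterminate at every position of `R`: a generic matrix for `R`.
-/
noncomputable def indeterminateMatrix (R : κ → J → Prop) :
    Matrix κ J (FractionRing (MvPolynomial (κ × J) ℚ)) :=
  .of fun e j => if R e j then algebraMap (MvPolynomial (κ × J) ℚ) _ (.X (e, j)) else 0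

theorem isGenericMatrix_indeterminateMatrix : IsGenericMatrix R (indeterminateMatrix R) := by
  classical
  refine ⟨fun h => by_contra fun hR => h (if_neg hR), fun {n r c} hr hc hR hdet => ?_⟩
  let P : Matrix (Fin n) (Fin n) (MvPolynomial (κ × J) ℚ) :=
    .of fun k l => if R (r k) (c l) then .X (r k, c l) else 0
  have hP : (indeterminateMatrix R).submatrix r c = P.map (algebraMap _ _) := by
    ext k l
    simp only [P, indeterminateMatrix, Matrix.submatrix_apply, Matrix.map_apply, Matrix.of_apply]
    rw [apply_ite (algebraMap _ _), map_zero]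
  -- Setting the diagonal indeterminates to `1` and the others to `0` gives the identity matrix.
  let σ : MvPolynomial (κ × J) ℚ →+* ℚ :=
    MvPolynomial.eval fun p => if ∃ k, p = (r k, c k) then 1 else 0
  have hσ : P.map σ = 1 := by
    ext k l
    have hkl : (∃ m, (r k, c l) = (r m, c m)) ↔ k = l := by
      simp only [Prod.mk.injEq, hr.eq_iff, hc.eq_iff]
      exact ⟨fun ⟨m, hk, hl⟩ => hk.trans hl.symm, fun h => ⟨k, rfl, h.symm⟩⟩
    simp only [P, σ, Matrix.map_apply, Matrix.of_apply, apply_ite, MvPolynomial.eval_X,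
      map_zero, hkl]
    rcases eq_or_ne k l with rfl | hne
    · rw [if_pos (hR k), if_pos rfl, Matrix.one_apply_eq]
    · rw [if_neg hne, ite_self, Matrix.one_apply_ne hne]
  rw [hP, ← RingHom.mapMatrix_apply, ← RingHom.map_det, FaithfulSMul.algebraMap_eq_zero_iff] at hdet
  have hone := RingHom.map_det σ P
  rw [RingHom.mapMatrix_apply, hσ, Matrix.det_one, hdet, map_zero] at hone
  exact zero_ne_one hone

theorem IsGenericMatrix.det_submatrix_ne_zero (hZ : IsGenericMatrix R Z) {m : Type*} [Fintype m]
    [DecidableEq m] {r : m → κ} {c : m → J} (hr : Function.Injective r)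
    (hc : Function.Injective c) (hR : ∀ k, R (r k) (c k)) : (Z.submatrix r c).det ≠ 0 := by
  let q := (Fintype.equivFin m).symm
  rw [← Matrix.det_submatrix_equiv_self q, Matrix.submatrix_submatrix]
  exact hZ.det_submatrix_fin_ne_zero (hr.comp q.injective) (hc.comp q.injective) fun k => hR _

theorem exists_perm_forall_ne_zero_of_det_ne_zero {m A : Type*} [Fintype m] [DecidableEq m]
    [CommRing A] {N : Matrix m m A} (h : N.det ≠ 0) :
    ∃ σ : Equiv.Perm m, ∀ k, N (σ k) k ≠ 0 := by
  rw [Matrix.det_apply'] at h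
  obtain ⟨σ, -, hσ⟩ := Finset.exists_ne_zero_of_sum_ne_zero h
  exact ⟨σ, fun k hk => hσ (mul_eq_zero_of_right _ (Finset.prod_eq_zero (Finset.mem_univ k) hk))⟩

variable {T : Finset κ}

theorem matchesInto_of_span_row_image_eq_top [Finite J] (hZ : ∀ {e j}, Z e j ≠ 0 → R e j)
    (hspan : Submodule.span K (Z.row '' T) = ⊤) : MatchesInto R T := by
  classical
  have := Fintype.ofFinite J
  obtain ⟨f, hfT, -, hf⟩ := Submodule.exists_fun_fin_finrank_span_eq K (Z.row '' (T : Set κ))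
  choose r hrT hrf using hfT
  let q : J ≃ Fin (Module.finrank K (Submodule.span K (Z.row '' (T : Set κ)))) :=
    Fintype.equivFinOfCardEq (by rw [hspan, finrank_top, Module.finrank_fintype_fun_eq_card])
  have hrow : (Z.submatrix (r ∘ q) id).row = f ∘ q := funext fun j => hrf (q j)
  have hunit : IsUnit (Z.submatrix (r ∘ q) id) := by
    rw [← Matrix.linearIndependent_rows_iff_isUnit, hrow]
    exact hf.comp q q.injective
  obtain ⟨σ, hσ⟩ := exists_perm_forall_ne_zero_of_det_ne_zero
    ((Matrix.isUnit_iff_isUnit_det _).1 hunit).ne_zero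
  have hr : Function.Injective r := .of_comp (f := Z.row) (by
    rw [show Z.row ∘ r = f from funext hrf]
    exact hf.injective)
  exact ⟨r ∘ q ∘ σ, hr.comp (q.injective.comp σ.injective), fun j => ⟨hrT _, hZ (hσ j)⟩⟩

theorem IsGenericMatrix.span_row_image_eq_top_iff [Finite J] (hZ : IsGenericMatrix R Z) :
    Submodule.span K (Z.row '' T) = ⊤ ↔ MatchesInto R T := by
  classical
  refine ⟨matchesInto_of_span_row_image_eq_top hZ.rel_of_ne_zero, fun ⟨g, hg, hgT⟩ => ?_⟩
  have := Fintype.ofFinite J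
  have hdet := hZ.det_submatrix_ne_zero hg Function.injective_id fun j => (hgT j).2
  have hindep : LinearIndependent K (Z.submatrix g id).row :=
    Matrix.linearIndependent_rows_iff_isUnit.2 ((Matrix.isUnit_iff_isUnit_det _).2 hdet.isUnit)
  have hspan := hindep.span_eq_top_of_card_eq_finrank' (Module.finrank_fintype_fun_eq_card K).symm
  refine top_unique (hspan.ge.trans (Submodule.span_mono ?_))
  rintro _ ⟨j, rfl⟩
  exact ⟨g j, (hgT j).1, rfl⟩

open Classical in
theorem IsGenericMatrix.card_lt_card_support [Fintype J] (hZ : IsGenericMatrix R Z) {x : J → K}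
    (hx : x ≠ 0) (hker : ∀ e ∈ T, Z.row e ⬝ᵥ x = 0) (hR : ∀ e ∈ T, ∃ j, x j ≠ 0 ∧ R e j) :
    T.card < Finset.card {j | x j ≠ 0} := by
  have hsupp : (Finset.univ.filter fun j => x j ≠ 0).Nonempty := by
    obtain ⟨j, hj⟩ := Function.ne_iff.1 hx
    exact ⟨j, by simpa using hj⟩
  rcases T.eq_empty_or_nonempty with rfl | hT
  · exact hsupp.card_pos
  by_contra! hle
  let t : κ → Finset J := fun e => {j | x j ≠ 0 ∧ R e j}
  have hmem {e : κ} {j : J} : j ∈ t e ↔ x j ≠ 0 ∧ R e j := by simp [t]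
  obtain ⟨s, hsT, ⟨a, ha⟩, f, hf, hft, himage⟩ := exists_subset_biUnion_eq_image (t := t) hT
    (fun e he => (hR e he).imp fun j hj => hmem.2 hj)
    (le_trans (Finset.card_le_card (Finset.biUnion_subset.2 fun e _ j hj => by
      simpa using (hmem.1 hj).1)) hle)
  have hdet := hZ.det_submatrix_ne_zero Subtype.val_injective hf fun e => (hmem.1 (hft e)).2
  -- The columns of `Z` in the range of `f` carry all nonzero terms of `Z.row e ⬝ᵥ x` for `e ∈ s`.
  have hmul : (Z.submatrix (Subtype.val : s → κ) f).mulVec (x ∘ f) = 0 := by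
    funext e
    rw [Pi.zero_apply, ← hker e (hsT e.2)]
    refine Finset.sum_of_injOn f hf.injOn (fun _ _ => Finset.mem_coe.2 (Finset.mem_univ _))
      (fun j _ hj => ?_) fun _ _ => rfl
    by_contra hne
    have hjt : j ∈ t e := hmem.2
      ⟨right_ne_zero_of_mul hne, hZ.rel_of_ne_zero (left_ne_zero_of_mul hne)⟩
    have hjf := himage ▸ Finset.mem_biUnion.2 ⟨(e : κ), e.2, hjt⟩
    exact hj (by simpa using hjf)
  exact (hmem.1 (hft ⟨a, ha⟩)).1
    (congr_fun (Matrix.eq_zero_of_mulVec_eq_zero hdet hmul) ⟨a, ha⟩)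

end GenericMatrix

section AssignmentVectors

variable {κ J : Type*}

theorem degree_sum_eq_card {u : κ → J →₀ ℕ} {Y : Finset κ}
    (hu : ∀ e ∈ Y, ∃ j, u e = Finsupp.single j 1) : (∑ e ∈ Y, u e).degree = Y.card := by
  rw [map_sum, Finset.card_eq_sum_ones]
  refine Finset.sum_congr rfl fun e he => ?_
  obtain ⟨j, hj⟩ := hu e he
  rw [hj, Finsupp.degree_single]

theorem exists_subset_sum_eq_of_le {u : κ → J →₀ ℕ} {Y : Finset κ} {b : J →₀ ℕ}
    (hu : ∀ e ∈ Y, ∃ j, u e = Finsupp.single j 1) (hb : b ≤ ∑ e ∈ Y, u e) :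
    ∃ X ⊆ Y, ∑ e ∈ X, u e = b := by
  classical
  induction Y using Finset.induction_on generalizing b with
  | empty => exact ⟨∅, subset_rfl, (nonpos_iff_eq_zero.1 hb).symm⟩
  | insert e Y he ih =>
    replace ih {c : J →₀ ℕ} := @ih c fun a ha => hu a (Finset.mem_insert_of_mem ha)
    rw [Finset.sum_insert he] at hb
    by_cases heb : u e ≤ b
    · obtain ⟨X, hXY, hX⟩ := ih (tsub_le_iff_left.2 hb)
      refine ⟨insert e X, Finset.insert_subset_insert e hXY, ?_⟩
      rw [Finset.sum_insert fun h => he (hXY h), hX, add_tsub_cancel_of_le heb]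
    · obtain ⟨j, hj⟩ := hu e (Finset.mem_insert_self e Y)
      rw [hj, Finsupp.single_le_iff, Nat.one_le_iff_ne_zero, not_not] at heb
      have hbY : b ≤ ∑ a ∈ Y, u a := fun i => by
        rcases eq_or_ne i j with rfl | hij
        · exact heb.trans_le zero_le
        · simpa [hj, hij] using hb i
      obtain ⟨X, hXY, hX⟩ := ih hbY
      exact ⟨X, hXY.trans (Finset.subset_insert e Y), hX⟩

variable [DecidableEq κ] {R : κ → J → Prop} {E : Finset κ}

/-- The exponent vectors obtained by choosing a subset `Y` of `E` whose complement still contains a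
matching that saturates `J`, and adding up one unit vector `u e` for each `e ∈ Y`, in the direction
of an element of `J` related to `e`. -/
def assignmentVectors (R : κ → J → Prop) (E : Finset κ) : Set (J →₀ ℕ) :=
  {a | ∃ Y ⊆ E, MatchesInto R (E \ Y) ∧ ∃ u : κ → J →₀ ℕ,
    (∀ e ∈ Y, ∃ j, R e j ∧ u e = Finsupp.single j 1) ∧ ∑ e ∈ Y, u e = a}

theorem finite_assignmentVectors [Finite J] : (assignmentVectors R E).Finite := by
  refine (Finsupp.finite_of_degree_le (σ := J) E.card).subset ?_
  rintro _ ⟨Y, hYE, -, u, hu, rfl⟩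
  rw [Set.mem_ofPred_eq, degree_sum_eq_card fun e he => (hu e he).imp fun _ h => h.2]
  exact Finset.card_le_card hYE

theorem zero_mem_assignmentVectors (h : MatchesInto R E) : 0 ∈ assignmentVectors R E :=
  ⟨∅, Finset.empty_subset E, by rwa [Finset.sdiff_empty], 0, by simp, Finset.sum_empty⟩

theorem mem_assignmentVectors_of_le {a b : J →₀ ℕ} (ha : a ∈ assignmentVectors R E) (hba : b ≤ a) :
    b ∈ assignmentVectors R E := by
  obtain ⟨Y, hYE, hmatch, u, hu, rfl⟩ := ha
  obtain ⟨X, hXY, rfl⟩ := exists_subset_sum_eq_of_le (fun e he => (hu e he).imp fun _ h => h.2) hba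
  exact ⟨X, hXY.trans hYE, hmatch.mono (Finset.sdiff_subset_sdiff subset_rfl hXY), u,
    fun e he => hu e (hXY he), rfl⟩

theorem single_add_mem_assignmentVectors {Y : Finset κ} {e : κ} {j : J} {u : κ → J →₀ ℕ}
    (hYE : insert e Y ⊆ E) (heY : e ∉ Y) (hmatch : MatchesInto R (E \ insert e Y)) (hj : R e j)
    (hu : ∀ a ∈ Y, ∃ i, R a i ∧ u a = Finsupp.single i 1) :
    Finsupp.single j 1 + ∑ a ∈ Y, u a ∈ assignmentVectors R E := by
  have hne {a : κ} (ha : a ∈ Y) : a ≠ e := fun h => heY (h ▸ ha)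
  refine ⟨insert e Y, hYE, hmatch, Function.update u e (Finsupp.single j 1), fun a ha => ?_, ?_⟩
  · rcases Finset.mem_insert.1 ha with rfl | ha
    · exact ⟨j, hj, Function.update_self ..⟩
    · rw [Function.update_of_ne (hne ha)]
      exact hu a ha
  · rw [Finset.sum_insert heY, Function.update_self]
    congr 1
    exact Finset.sum_congr rfl fun a ha => Function.update_of_ne (hne ha) ..

open Classical in
theorem MatchesInto.card_filter_add_card_le {Y : Finset κ} (h : MatchesInto R (E \ Y))
    (hYE : Y ⊆ E) (S : Finset J) : Finset.card {e ∈ Y | ∃ j ∈ S, R e j} + S.card ≤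
      Finset.card {e ∈ E | ∃ j ∈ S, R e j} := by
  obtain ⟨g, hg, hgY⟩ := h
  rw [← Finset.card_image_of_injective S hg, ← Finset.card_union_of_disjoint]
  · refine Finset.card_le_card (Finset.union_subset (Finset.filter_subset_filter _ hYE) ?_)
    refine Finset.image_subset_iff.2 fun j hj => Finset.mem_filter.2
      ⟨(Finset.mem_sdiff.1 (hgY j).1).1, j, hj, (hgY j).2⟩
  · refine Finset.disjoint_right.2 fun e he heY => ?_
    obtain ⟨j, -, rfl⟩ := Finset.mem_image.1 he
    exact (Finset.mem_sdiff.1 (hgY j).1).2 (Finset.mem_filter.1 heY).1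

open Classical in
theorem sum_add_card_le_of_mem_assignmentVectors {a : J →₀ ℕ} (ha : a ∈ assignmentVectors R E)
    (S : Finset J) : ∑ j ∈ S, a j + S.card ≤ Finset.card {e ∈ E | ∃ j ∈ S, R e j} := by
  obtain ⟨Y, hYE, hmatch, u, hu, rfl⟩ := ha
  refine le_trans ?_ (hmatch.card_filter_add_card_le hYE S)
  simp only [Finsupp.finsetSum_apply]
  rw [Finset.sum_comm, Finset.card_filter]
  gcongr with e he
  obtain ⟨j, hRj, hj⟩ := hu e he
  simp only [hj, Finsupp.single_apply, Finset.sum_ite_eq]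
  split_ifs with hjS hex <;> first | omega | exact absurd ⟨j, hjS, hRj⟩ hex

open Classical in
theorem degree_add_card_of_maximal [Fintype J] {a : J →₀ ℕ}
    (ha : Maximal (· ∈ assignmentVectors R E) a) :
    a.degree + Fintype.card J = Finset.card {e ∈ E | ∃ j, R e j} := by
  refine le_antisymm ?_ ?_
  · simpa [Finsupp.degree_eq_sum] using
      sum_add_card_le_of_mem_assignmentVectors ha.prop Finset.univ
  obtain ⟨Y, hYE, ⟨g, hg, hgY⟩, u, hu, rfl⟩ := ha.prop
  -- A related element neither assigned nor matched could be assigned as well.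
  suffices h : ({e ∈ E | ∃ j, R e j} : Finset κ) ⊆ Y ∪ Finset.univ.image g by
    refine (Finset.card_le_card h).trans ((Finset.card_union_le _ _).trans ?_)
    rw [degree_sum_eq_card fun e he => (hu e he).imp fun _ h => h.2,
      Finset.card_image_of_injective _ hg, Finset.card_univ]
  intro e he
  obtain ⟨heE, j, hj⟩ := Finset.mem_filter.1 he
  by_contra hnot
  simp only [Finset.mem_union, Finset.mem_image, Finset.mem_univ, true_and, not_or, not_exists]
    at hnot
  obtain ⟨heY, heg⟩ := hnot
  have hmatch : MatchesInto R (E \ insert e Y) := by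
    refine ⟨g, hg, fun i => ⟨?_, (hgY i).2⟩⟩
    rw [Finset.sdiff_insert]
    exact Finset.mem_erase.2 ⟨heg i, (hgY i).1⟩
  have hle := ha.le_of_ge (single_add_mem_assignmentVectors (Finset.insert_subset heE hYE) heY
    hmatch hj hu) le_add_self
  simpa using hle j

end AssignmentVectors

section Monomials

open SymmetricAlgebra Module

variable {K J : Type*} [Field K] [Fintype J]

variable (K) in
/-- The monomial with exponent vector `a` in the coordinate vectors, as an element of the symmetric
algebra of `J → K`. -/
noncomputable def coordMonomial (a : J →₀ ℕ) : SymmetricAlgebra K (J → K) :=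
  (equivMvPolynomial (Pi.basisFun K J)).symm (.monomial a 1)

theorem coordMonomial_zero : coordMonomial K (0 : J →₀ ℕ) = 1 :=
  map_one _

theorem coordMonomial_add (a b : J →₀ ℕ) :
    coordMonomial K (a + b) = coordMonomial K a * coordMonomial K b := by
  rw [coordMonomial, coordMonomial, coordMonomial, ← map_mul, MvPolynomial.monomial_mul, one_mul]

theorem coordMonomial_sum {κ : Type*} (Y : Finset κ) (u : κ → J →₀ ℕ) :
    coordMonomial K (∑ e ∈ Y, u e) = ∏ e ∈ Y, coordMonomial K (u e) := by
  rw [coordMonomial, MvPolynomial.monomial_sum_one, map_prod]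
  rfl

theorem coordMonomial_single [DecidableEq J] (j : J) (n : ℕ) :
    coordMonomial K (Finsupp.single j n) = ι K (J → K) (Pi.single j 1) ^ n := by
  rw [coordMonomial, ← MvPolynomial.X_pow_eq_monomial, map_pow, equivMvPolynomial_symm_X,
    Pi.basisFun_apply]

theorem linearIndependent_coordMonomial : LinearIndependent K (coordMonomial K (J := J)) := by
  have h := (MvPolynomial.basisMonomials J K).linearIndependent
  rw [MvPolynomial.coe_basisMonomials] at h
  exact h.map' (equivMvPolynomial (Pi.basisFun K J)).symm.toLinearMap
    (LinearMap.ker_eq_bot.2 (AlgEquiv.injective _))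

theorem coordMonomial_mem_homogeneousPart (a : J →₀ ℕ) :
    coordMonomial K a ∈ homogeneousPart K (J → K) a.degree := by
  classical
  induction a using Finsupp.induction_linear with
  | zero =>
    rw [coordMonomial_zero, map_zero]
    exact Submodule.one_le.1 le_rfl
  | add a b ha hb =>
    rw [coordMonomial_add, map_add]
    exact mul_mem_homogeneousPart ha hb
  | single j n =>
    rw [coordMonomial_single, Finsupp.degree_single]
    exact Submodule.pow_mem_pow _ (LinearMap.mem_range_self ..) n

theorem ι_mem_span_coordMonomial (z : J → K) : ι K (J → K) z ∈
    Submodule.span K (coordMonomial K '' {b | ∃ j, z j ≠ 0 ∧ b = Finsupp.single j 1}) := by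
  classical
  have hz : ι K (J → K) z = ∑ j, z j • coordMonomial K (Finsupp.single j 1) := by
    simp only [coordMonomial_single, pow_one, ← map_smul, ← map_sum, ← pi_eq_sum_univ' z]
  rw [hz]
  refine Submodule.sum_mem _ fun j _ => ?_
  by_cases hj : z j = 0
  · rw [hj, zero_smul]
    exact Submodule.zero_mem _
  · exact Submodule.smul_mem _ _ (Submodule.subset_span ⟨_, ⟨j, hj, rfl⟩, rfl⟩)

open Classical in
theorem degree_restrictLine_coordMonomial (η : Dual K (J → K)) (a : J →₀ ℕ) :
    (restrictLine η (coordMonomial K a)).degree =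
      (∑ j with η (Pi.single j 1) ≠ 0, a j : ℕ) := by
  induction a using Finsupp.induction_linear with
  | zero => simp [coordMonomial_zero]
  | add a b ha hb =>
    rw [coordMonomial_add, map_mul, degree_mul, ha, hb, ← Nat.cast_add, ← Finset.sum_add_distrib]
    rfl
  | single j n =>
    have hι := degree_restrictLine_ι_mul η (w := Pi.single j (1 : K)) (by simp) 1
    rw [mul_one, map_one, degree_one, add_zero] at hι
    rw [coordMonomial_single, map_pow, degree_pow, hι]
    by_cases hj : η (Pi.single j 1) = 0 <;> simp [hj, Finsupp.single_apply]

end Monomials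

section Squeeze

open SymmetricAlgebra Module
open scoped Pointwise

variable {κ J K : Type*} [Field K]

theorem prod_mem_span_finsetProd {A : Type*} [CommRing A] [Algebra K A] (Y : Finset κ) {f : κ → A}
    {s : κ → Set A} (h : ∀ e ∈ Y, f e ∈ Submodule.span K (s e)) :
    ∏ e ∈ Y, f e ∈ Submodule.span K (∏ e ∈ Y, s e) := by
  classical
  rw [← Submodule.prod_span]
  induction Y using Finset.induction_on with
  | empty => exact Submodule.one_le.1 le_rfl
  | insert e Y he ih =>
    rw [Finset.prod_insert he, Finset.prod_insert he]
    exact Submodule.mul_mem_mul (h e (Finset.mem_insert_self e Y))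
      (ih fun a ha => h a (Finset.mem_insert_of_mem ha))

variable [Fintype J] [DecidableEq κ] {R : κ → J → Prop} {Z : Matrix κ J K} {E : Finset κ}

theorem prod_ι_row_mem_span (hZ : ∀ {e j}, Z e j ≠ 0 → R e j) {Y : Finset κ} (hYE : Y ⊆ E)
    (hmatch : MatchesInto R (E \ Y)) : ∏ e ∈ Y, ι K (J → K) (Z.row e) ∈
      Submodule.span K (coordMonomial K '' {a ∈ assignmentVectors R E | a.degree = Y.card}) := by
  refine Submodule.span_mono ?_
    (prod_mem_span_finsetProd Y fun e _ => ι_mem_span_coordMonomial (Z.row e))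
  intro f hf
  obtain ⟨p, hp, rfl⟩ := (Set.mem_finsetProd ..).1 hf
  choose! u hu hup using fun e (he : e ∈ Y) => hp he
  have hu' (e : κ) (he : e ∈ Y) : ∃ j, R e j ∧ u e = Finsupp.single j 1 :=
    (hu e he).imp fun j hj => ⟨hZ hj.1, hj.2⟩
  refine ⟨∑ e ∈ Y, u e, ⟨⟨Y, hYE, hmatch, u, hu', rfl⟩,
    degree_sum_eq_card fun e he => (hu' e he).imp fun _ h => h.2⟩, ?_⟩
  rw [coordMonomial_sum]
  exact Finset.prod_congr rfl fun e he => hup e he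

theorem IsGenericMatrix.productSpace_le_span (hZ : IsGenericMatrix R Z) {i : ℕ} :
    productSpace K Z.row E i ≤
      Submodule.span K (coordMonomial K '' {a ∈ assignmentVectors R E | a.degree = i}) := by
  rw [productSpace_le_iff]
  rintro Y hY rfl
  obtain ⟨hYE, hspan⟩ := mem_cospanning.1 hY
  exact prod_ι_row_mem_span hZ.rel_of_ne_zero hYE (hZ.span_row_image_eq_top_iff.1 hspan)

open Classical in
theorem IsGenericMatrix.sum_lt_nonvanishingCount (hZ : IsGenericMatrix R Z) {a : J →₀ ℕ}
    (ha : a ∈ assignmentVectors R E) {η : Dual K (J → K)} (hη : η ≠ 0) :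
    ∑ j with η (Pi.single j 1) ≠ 0, a j < nonvanishingCount Z.row E η := by
  set x : J → K := fun j => η (Pi.single j 1)
  have hηx (z : J → K) : η z = z ⬝ᵥ x := by
    conv_lhs => rw [pi_eq_sum_univ' z, map_sum]
    simp only [map_smul, smul_eq_mul]
    rfl
  have hx : x ≠ 0 := fun h => hη (LinearMap.ext fun z => by rw [hηx, h, dotProduct_zero]; rfl)
  let S : Finset J := {j | x j ≠ 0}
  let U : Finset κ := {e ∈ E | ∃ j ∈ S, R e j}
  have hle : ∑ j ∈ S, a j + S.card ≤ U.card := sum_add_card_le_of_mem_assignmentVectors ha S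
  have hlt : Finset.card {e ∈ U | η (Z.row e) = 0} < S.card := by
    refine hZ.card_lt_card_support hx (fun e he => ?_) fun e he => ?_
    · rw [← hηx]
      exact (Finset.mem_filter.1 he).2
    · obtain ⟨j, hjS, hj⟩ := (Finset.mem_filter.1 (Finset.mem_filter.1 he).1).2
      exact ⟨j, (Finset.mem_filter.1 hjS).2, hj⟩
  have hsplit := Finset.card_filter_add_card_filter_not (s := U) fun e => η (Z.row e) = 0
  have hcount : Finset.card {e ∈ U | ¬η (Z.row e) = 0} ≤ nonvanishingCount Z.row E η :=
    Finset.card_le_card (Finset.filter_subset_filter _ (Finset.filter_subset _ E))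
  change ∑ j ∈ S, a j < _
  omega

theorem IsGenericMatrix.span_le_lineDegreeSpace (hZ : IsGenericMatrix R Z) {i : ℕ} :
    Submodule.span K (coordMonomial K '' {a ∈ assignmentVectors R E | a.degree = i}) ≤
      lineDegreeSpace K Z.row E i := by
  rw [Submodule.span_le]
  rintro _ ⟨a, ⟨ha, rfl⟩, rfl⟩
  refine mem_lineDegreeSpace.2 ⟨coordMonomial_mem_homogeneousPart a, fun η hη => ?_⟩
  rw [degree_restrictLine_coordMonomial]
  exact_mod_cast hZ.sum_lt_nonvanishingCount ha hη

theorem finrank_span_coordMonomial_image (s : Set (J →₀ ℕ)) [Finite s] :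
    finrank K (Submodule.span K (coordMonomial K '' s)) = s.ncard := by
  have := Fintype.ofFinite s
  have h := linearIndependent_coordMonomial (K := K).comp ((↑) : s → J →₀ ℕ) Subtype.val_injective
  rw [← Nat.card_coe_set_eq, Nat.card_eq_fintype_card, ← finrank_span_eq_card h, Set.range_comp,
    Subtype.range_coe]

end Squeeze

theorem IsGenericMatrix.coeff_cospanningHPolynomial {κ J K : Type*} [Field K] [Finite J]
    [DecidableEq κ] {R : κ → J → Prop} {Z : Matrix κ J K} {E : Finset κ}
    (hZ : IsGenericMatrix R Z) (i : ℕ) :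
    (cospanningHPolynomial K Z.row E).coeff i =
      {a ∈ assignmentVectors R E | a.degree = i}.ncard := by
  have := Fintype.ofFinite J
  have hfin := finite_assignmentVectors (R := R) (E := E)
    |>.subset (Set.sep_subset _ (·.degree = i))
  have := hfin.to_subtype
  have := FiniteDimensional.span_of_finite K (hfin.image (coordMonomial K))
  rw [← finrank_span_coordMonomial_image (K := K)]
  refine le_antisymm ?_ ?_
  · exact coeff_le_finrank_productSpace.trans
      (mod_cast Submodule.finrank_mono hZ.productSpace_le_span)
  · exact le_trans (mod_cast Submodule.finrank_mono hZ.span_le_lineDegreeSpace)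
      finrank_lineDegreeSpace_le_coeff

section Matroid

open Module

variable {α : Type*} {M : Matroid α}

section Transversal

variable {κ : Type*} {A : κ → Set α} {B I : Set α}

theorem IsPartialTransversal.insert {f : I → κ} (hf : Function.Injective f)
    (hfA : ∀ x : I, (x : α) ∈ A (f x)) {b : α} {k : κ} (hbk : b ∈ A k) (hk : k ∉ Set.range f) :
    IsPartialTransversal A (insert b I) := by
  classical
  refine ⟨fun x => if h : (x : α) ∈ I then f ⟨x, h⟩ else k, fun x y hxy => ?_, fun x => ?_⟩
  · simp only at hxy
    split_ifs at hxy with hx hy hy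
    · exact Subtype.ext (Subtype.mk.inj (hf hxy))
    · exact absurd ⟨_, hxy⟩ hk
    · exact absurd ⟨_, hxy.symm⟩ hk
    · exact Subtype.ext ((x.2.resolve_right hx).trans (y.2.resolve_right hy).symm)
  · dsimp only
    split_ifs with h
    · exact hfA ⟨x, h⟩
    · rwa [x.2.resolve_right h]

/-- The set of elements that two matchings send to the same index: the quantity that increases when
one matching is exchanged towards the other. -/
def matchingAgreement (f : I → κ) (g : B → κ) : Set α :=
  {x | ∃ (hI : x ∈ I) (hB : x ∈ B), f ⟨x, hI⟩ = g ⟨x, hB⟩}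

theorem exists_matchingAgreement_ssubset {f : I → κ} (hf : Function.Injective f)
    (hfA : ∀ x : I, (x : α) ∈ A (f x)) {g : B → κ} (hgA : ∀ b : B, (b : α) ∈ A (g b)) {b : B}
    (hbI : (b : α) ∈ I) (hb : g b ∉ Set.range f) :
    ∃ f' : I → κ, Function.Injective f' ∧ (∀ x : I, (x : α) ∈ A (f' x)) ∧
      matchingAgreement f g ⊂ matchingAgreement f' g := by
  classical
  let f' := Function.update f ⟨b, hbI⟩ (g b)
  have hself : f' ⟨b, hbI⟩ = g b := Function.update_self ..
  have hne (x : I) (hx : x ≠ ⟨b, hbI⟩) : f' x = f x := Function.update_of_ne hx ..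
  refine ⟨f', fun x y hxy => ?_, fun x => ?_,
    Set.ssubset_iff_exists.2 ⟨?_, b, ⟨hbI, b.2, hself⟩, ?_⟩⟩
  · by_cases hx : x = ⟨b, hbI⟩ <;> by_cases hy : y = ⟨b, hbI⟩
    · rw [hx, hy]
    · rw [hx, hself, hne y hy] at hxy
      exact absurd ⟨y, hxy.symm⟩ hb
    · rw [hy, hself, hne x hx] at hxy
      exact absurd ⟨x, hxy⟩ hb
    · rw [hne x hx, hne y hy] at hxy
      exact hf hxy
  · by_cases hx : x = ⟨b, hbI⟩
    · rw [hx, hself]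
      exact hgA b
    · rw [hne x hx]
      exact hfA x
  · rintro x ⟨hxI, hxB, hx⟩
    refine ⟨hxI, hxB, ?_⟩
    rwa [hne]
    intro heq
    obtain rfl : x = b := congrArg Subtype.val heq
    exact hb ⟨_, hx⟩
  · rintro ⟨_, _, h⟩
    exact hb ⟨_, h⟩

theorem exists_matching_range_eq (hA : ∀ I, M.Indep I ↔ IsPartialTransversal A I) [Finite B]
    (hB : M.IsBase B) (hI : M.IsBase I) {g : B → κ} (hg : Function.Injective g)
    (hgA : ∀ b : B, (b : α) ∈ A (g b)) :
    ∃ f : I → κ, Function.Injective f ∧ (∀ x : I, (x : α) ∈ A (f x)) ∧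
      Set.range f = Set.range g := by
  obtain ⟨f, ⟨hf, hfA⟩, hmax⟩ := Set.Finite.exists_maximalFor' (matchingAgreement · g)
    {f : I → κ | Function.Injective f ∧ ∀ x : I, (x : α) ∈ A (f x)}
    (B.toFinite.powerset.subset <| by rintro _ ⟨f, -, rfl⟩ x ⟨-, hx, -⟩; exact hx)
    ((hA I).1 hI.indep)
  have : Finite I := hB.finite_of_finite B.toFinite hI
  refine ⟨f, hf, hfA, (Set.eq_of_subset_of_ncard_le ?_ ?_).symm⟩
  · rintro _ ⟨b, rfl⟩
    by_contra hb
    by_cases hbI : (b : α) ∈ I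
    · obtain ⟨f', hf', hfA', hlt⟩ := exists_matchingAgreement_ssubset hf hfA hgA hbI hb
      exact hlt.not_subset (hmax ⟨hf', hfA'⟩ hlt.subset)
    · have hins : M.Indep (insert (b : α) I) :=
        (hA _).2 (IsPartialTransversal.insert hf hfA (hgA b) hb)
      exact hbI (hI.mem_of_insert_indep hins)
  · rw [← Set.image_univ, ← Set.image_univ, Set.ncard_image_of_injective _ hf,
      Set.ncard_image_of_injective _ hg, Set.ncard_univ, Set.ncard_univ, Nat.card_coe_set_eq,
      Nat.card_coe_set_eq, hB.ncard_eq_ncard_of_isBase hI]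

theorem spanning_iff_matchesInto (hA : ∀ I, M.Indep I ↔ IsPartialTransversal A I) [Finite B]
    (hB : M.IsBase B) {g : B → κ} (hg : Function.Injective g) (hgA : ∀ b : B, (b : α) ∈ A (g b))
    {J : Type*} (q : J ≃ B) {T : Finset α} (hT : (T : Set α) ⊆ M.E) :
    M.Spanning T ↔ MatchesInto (fun e j => e ∈ A (g (q j))) T := by
  rw [Matroid.spanning_iff_exists_isBase_subset hT]
  constructor
  · rintro ⟨I, hI, hIT⟩
    obtain ⟨f, -, hfA, hrange⟩ := exists_matching_range_eq hA hB hI hg hgA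
    choose h hh using fun j => (hrange ▸ Set.mem_range_self (q j) : g (q j) ∈ Set.range f)
    refine ⟨fun j => h j, fun i j hij => ?_, fun j => ⟨hIT (h j).2, by
      simpa only [hh] using hfA (h j)⟩⟩
    exact q.injective (hg (by rw [← hh, ← hh, Subtype.ext hij]))
  · rintro ⟨h, hinj, hh⟩
    let r := Equiv.ofInjective h hinj
    have hI : M.Indep (Set.range h) := (hA _).2
      ⟨fun x => g (q (r.symm x)), hg.comp (q.injective.comp r.symm.injective), fun x => by
        simpa only [r, Equiv.apply_ofInjective_symm] using (hh (r.symm x)).2⟩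
    have := Finite.of_equiv B (q.symm.trans r)
    refine ⟨_, hI.isBase_of_eRk_ge (Set.toFinite _) ?_, Set.range_subset_iff.2 fun j => (hh j).1⟩
    rw [hI.eRk_eq_encard, ← hB.encard_eq_eRank, ← Set.encard_congr (q.symm.trans r)]

theorem exists_spanning_iff_matchesInto [M.RankFinite]
    (hM : M.IsTransversal) : ∃ (d : ℕ) (R : α → Fin d → Prop), M.eRank = d ∧
      ∀ T : Finset α, (T : Set α) ⊆ M.E → (M.Spanning T ↔ MatchesInto R T) := by
  obtain ⟨m, A, -, hA⟩ := hM
  obtain ⟨B, hB⟩ := M.exists_isBase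
  have hfin : Finite B := hB.finite
  obtain ⟨g, hg, hgA⟩ := (hA B).1 hB.indep
  refine ⟨Nat.card B, _, ?_, fun T =>
    spanning_iff_matchesInto hA hB hg hgA (Finite.equivFin B).symm⟩
  rw [← hB.encard_eq_eRank, Nat.card_coe_set_eq, Set.Finite.cast_ncard_eq hfin]

end Transversal

theorem numIndep_eq_card {𝒮 : Finset (Finset α)} (h𝒮 : ∀ Y, Y ∈ 𝒮 ↔ M.Indep Y) (k : ℕ) :
    M.numIndep k = Finset.card {Y ∈ 𝒮 | Y.card = k} := by
  rw [Matroid.numIndep, ← Set.ncard_coe_finset, ← Set.ncard_image_of_injective _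
    Finset.coe_injective]
  congr 1
  ext I
  simp only [Set.mem_ofPred_eq, Set.mem_image, Finset.mem_coe, Finset.mem_filter, h𝒮]
  constructor
  · rintro ⟨hI, hk⟩
    lift I to Finset α using Set.finite_of_encard_eq_coe hk
    rw [Set.encard_coe_eq_coe_finsetCard] at hk
    exact ⟨I, ⟨hI, mod_cast hk⟩, rfl⟩
  · rintro ⟨Y, ⟨hY, rfl⟩, rfl⟩
    exact ⟨hY, Set.encard_coe_eq_coe_finsetCard Y⟩

theorem hPolynomial_eq_sum [M.RankFinite] {𝒮 : Finset (Finset α)}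
    (h𝒮 : ∀ Y, Y ∈ 𝒮 ↔ M.Indep Y) :
    M.hPolynomial = ∑ Y ∈ 𝒮, X ^ Y.card * (1 - X) ^ (M.eRank.toNat - Y.card) := by
  have hmaps (Y) (hY : Y ∈ 𝒮) : Y.card ∈ Finset.range (M.eRank.toNat + 1) := by
    have hle := ENat.toNat_le_toNat ((h𝒮 Y).1 hY).encard_le_eRank (M.eRank_ne_top_iff.2 ‹_›)
    rw [Set.encard_coe_eq_coe_finsetCard, ENat.toNat_natCast] at hle
    exact Finset.mem_range.2 (Nat.lt_succ_of_le hle)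
  rw [Matroid.hPolynomial, ← Finset.sum_fiberwise_of_maps_to hmaps]
  refine Finset.sum_congr rfl fun k _ => ?_
  rw [numIndep_eq_card h𝒮, mul_assoc, ← nsmul_eq_mul, ← Finset.sum_const]
  refine Finset.sum_congr rfl fun Y hY => ?_
  rw [(Finset.mem_filter.1 hY).2]

theorem hPolynomial_eq_cospanningHPolynomial {K V : Type*} [Field K] [AddCommGroup V] [Module K V]
    [DecidableEq α] {v : α → V} {E : Finset α} (hE : (E : Set α) = M.E)
    (hrank : M✶.eRank = finrank K V)
    (hv : ∀ T ⊆ E, M✶.Spanning T ↔ Submodule.span K (v '' T) = ⊤) :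
    M.hPolynomial = cospanningHPolynomial K v E := by
  have hfin : M.Finite := ⟨hE ▸ E.finite_toSet⟩
  have hindep (Y : Finset α) : Y ∈ cospanning K v E ↔ M.Indep Y := by
    rw [mem_cospanning, ← hv _ Finset.sdiff_subset, Finset.coe_sdiff, ← Finset.coe_subset, hE,
      ← M.dual_coindep_iff]
    exact ⟨fun ⟨hYE, hY⟩ => (M✶.coindep_iff_compl_spanning hYE).2 hY,
      fun hY => ⟨hY.subset_ground, hY.compl_spanning⟩⟩
  have hr : M.eRank.toNat = E.card - finrank K V := by
    have hsum := congrArg ENat.toNat M.eRank_add_eRank_dual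
    rw [hrank, ENat.toNat_add (M.eRank_ne_top_iff.2 inferInstance) (ENat.natCast_ne_top _), ← hE,
      Set.encard_coe_eq_coe_finsetCard, ENat.toNat_natCast, ENat.toNat_natCast] at hsum
    omega
  rw [hPolynomial_eq_sum hindep, hr]
  rfl

end Matroid

theorem mainTheorem1 {α : Type*} (M : Matroid α) [M.Finite] (hM : M.IsCotransversal) :
    IsPureOSequence M.hVector := by
  classical
  obtain ⟨d, R, hd, hR⟩ := exists_spanning_iff_matchesInto hM
  obtain ⟨E, hE⟩ := M.ground_finite.exists_finset_coe
  have hspan (T) (hT : T ⊆ E) : M✶.Spanning T ↔ MatchesInto R T :=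
    hR T (hE ▸ Finset.coe_subset.2 hT)
  have hZ := isGenericMatrix_indeterminateMatrix (R := R)
  have hmatch : MatchesInto R E := (hspan E subset_rfl).1 (hE ▸ M✶.ground_spanning)
  have hS (a) : a ∈ finite_assignmentVectors.toFinset ↔ a ∈ assignmentVectors R E :=
    Set.Finite.mem_toFinset _
  refine ⟨d, finite_assignmentVectors.toFinset, ⟨⟨0, (hS 0).2 (zero_mem_assignmentVectors hmatch)⟩,
    fun a ha b hb => (hS b).2 (mem_assignmentVectors_of_le ((hS a).1 ha) hb)⟩,
    fun a b ha hb => ?_, fun i => ?_⟩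
  · simp only [hS] at ha hb
    have hdega := degree_add_card_of_maximal ha
    have hdegb := degree_add_card_of_maximal hb
    omega
  · have hh : M.hPolynomial = cospanningHPolynomial _ (indeterminateMatrix R).row E :=
      hPolynomial_eq_cospanningHPolynomial hE (by rw [hd, Module.finrank_fin_fun]) fun T hT =>
        (hspan T hT).trans hZ.span_row_image_eq_top_iff.symm
    rw [Matroid.hVector, hh, hZ.coeff_cospanningHPolynomial, ← Set.ncard_coe_finset]
    congr 2
    ext a
    simp only [Finset.coe_filter, hS, Set.mem_ofPred_eq]
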